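/- Let $N\ge 1$, let $\Omega\subset\mathbb R^N$ be a bounded open set, let $a,b\in C(\overline\Omega)$ be real-valued (they may change sign), let $\lambda\in\mathbb R$, $1<q<2$, $\alpha,\beta>1$, and, if $N\ge 3$, let $\alpha+\beta<\frac{2N}{N-2}$. On $W=H_0^1(\Omega)\times H_0^1(\Omega)$ with the norm $\|(u,v)\|_H=\big(\int_\Omega|\nabla u|^2+\int_\Omega|\nabla v|^2\big)^{1/2}$ consider $$J_\lambda(u,v)=\tfrac12\|(u,v)\|_H^2-\tfrac{\lambda}{q}\Big(\int_\Omega a|u|^q+\int_\Omega a|v|^q\Big)-\tfrac1{\alpha+\beta}\int_\Omega b|u|^\alpha|v|^\beta ,$$ the energy functional of the system $-\Delta u=\lambda a|u|^{q-2}u+\frac{\alpha}{\alpha+\beta}b|u|^{\alpha-2}u|v|^\beta$, $-\Delta v=\lambda a|v|^{q-2}v+\frac{\beta}{\alpha+\beta}b|u|^\alpha|v|^{\beta-2}v$ in $\Omega$, $u=v=0$ on $\partial\Omega$, and its Nehari manifold $M_\lambda(\Omega)=\{w\in W:\langle J_\lambda'(w),w\rangle=0\}$, where $\langle J_\lambda'(w),w\rangle$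 is the derivative of $J_\lambda$ at $w$ in the direction $w$. Let $S$ be the norm of the embedding of $H_0^1(\Omega)$ in $L^{\alpha+\beta}(\Omega)$, that is, the least $C\ge 0$ with $\|u\|_{L^{\alpha+\beta}(\Omega)}\le C\,(\int_\Omega|\nabla u|^2)^{1/2}$ for all $u\in H_0^1(\Omega)$, and let $r=\frac{\alpha+\beta}{\alpha+\beta-q}$. Then $J_\lambda$ is coercive on $M_\lambda(\Omega)$ (that is, $J_\lambda(w)\to\infty$ as $\|w\|_H\to\infty$ with $w\in M_\lambda(\Omega)$) and bounded below on $M_\lambda(\Omega)$; more precisely, for all $(u,v)\in M_\lambda(\Omega)$, $$J_\lambda(u,v)\ \ge\ \frac{S^{\frac{2q}{2-q}}\,(q-2)\,(\alpha+\beta-q)^{\frac{2}{2-q}}}{2q(\alpha+\beta)(\alpha+\beta-2)^{\frac{q}{2-q}}}\Big[\big(|\lambda|\,\|a\|_{L^{r}(\Omega)}\big)^{\frac{2}{2-q}}+\big(|\lambda|\,\|a\|_{L^{r}(\Omega)}\big)^{\frac{2}{2-q}}\Big].$$ -/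

import Mathlib

open MeasureTheory

noncomputable section

namespace LaplacianSystem

/-- Euclidean space `ℝ^N`. -/
abbrev E (N : ℕ) : Type := EuclideanSpace ℝ (Fin N)

/-- `φ ∈ C_c^∞(Ω)`. -/
def IsTest {N : ℕ} (Ω : Set (E N)) (φ : E N → ℝ) : Prop :=
  ContDiff ℝ ((⊤ : ℕ∞) : WithTop ℕ∞) φ ∧ HasCompactSupport φ ∧ tsupport φ ⊆ Ω

/-- `L²(Ω) × L²(Ω; ℝ^N)`, in which a function `u ∈ H¹(Ω)` is represented by the pair `(u, ∇u)`;
the topology induced on such pairs is that of the `H¹` norm. -/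
abbrev L2Pair (N : ℕ) (Ω : Set (E N)) : Type :=
  Lp ℝ 2 ((volume : Measure (E N)).restrict Ω) × Lp (E N) 2 ((volume : Measure (E N)).restrict Ω)

/-- The pairs `(φ, ∇φ)` with `φ ∈ C_c^∞(Ω)`. -/
def testPairs (N : ℕ) (Ω : Set (E N)) : Submodule ℝ (L2Pair N Ω) where
  carrier := {w | ∃ φ : E N → ℝ, IsTest Ω φ ∧
    w.1 =ᵐ[(volume : Measure (E N)).restrict Ω] φ ∧
    w.2 =ᵐ[(volume : Measure (E N)).restrict Ω] gradient φ}
  zero_mem' := by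
    refine ⟨0, ⟨contDiff_const, HasCompactSupport.zero, by simp [tsupport]⟩, ?_, ?_⟩
    · exact Lp.coeFn_zero _ _ _
    · filter_upwards [Lp.coeFn_zero (E N) 2 ((volume : Measure (E N)).restrict Ω)] with x hx
      have h0 : gradient (0 : E N → ℝ) x = 0 := gradient_fun_const x 0
      rw [h0]
      exact hx
  add_mem' := by
    rintro w z ⟨φ, ⟨h1, h2, h3⟩, h4, h5⟩ ⟨ψ, ⟨k1, k2, k3⟩, k4, k5⟩
    refine ⟨φ + ψ, ⟨h1.add k1, h2.add k2, (tsupport_add φ ψ).trans (Set.union_subset h3 k3)⟩,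
      ?_, ?_⟩
    · exact (Lp.coeFn_add w.1 z.1).trans (h4.add k4)
    · filter_upwards [Lp.coeFn_add w.2 z.2, h5, k5] with x hx hx5 kx5
      have hd : gradient (φ + ψ) x = gradient φ x + gradient ψ x := by
        simp only [gradient]
        rw [fderiv_add (h1.differentiable (by simp) x) (k1.differentiable (by simp) x), map_add]
      rw [hd, ← hx5, ← kx5]
      exact hx
  smul_mem' := by
    rintro c w ⟨φ, ⟨h1, h2, h3⟩, h4, h5⟩
    refine ⟨c • φ, ⟨contDiff_const.smul h1, h2.smul_left (f := fun _ => c),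
      (closure_mono (Function.support_const_smul_subset c φ)).trans h3⟩, ?_, ?_⟩
    · exact (Lp.coeFn_smul c w.1).trans (h4.const_smul c)
    · filter_upwards [Lp.coeFn_smul c w.2, h5] with x hx hx5
      have hd : gradient (c • φ) x = c • gradient φ x := by
        simp only [gradient]
        rw [fderiv_const_smul (h1.differentiable (by simp) x), map_smulₛₗ]
        simp
      rw [hd, ← hx5]
      exact hx

/-- The Sobolev space `H¹₀(Ω)`: the closure of `C_c^∞(Ω)` in the `H¹` norm. -/
def H10 (N : ℕ) (Ω : Set (E N)) : Submodule ℝ (L2Pair N Ω) :=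
  (testPairs N Ω).topologicalClosure

variable {N : ℕ} {Ω : Set (E N)}

/-- The function `u` underlying an element of `H¹₀(Ω)`. -/
def fn (u : H10 N Ω) : E N → ℝ := fun x => u.1.1 x

/-- The weak gradient `∇u` of an element of `H¹₀(Ω)`. -/
def grad (u : H10 N Ω) : E N → E N := fun x => u.1.2 x

/-- `∫_Ω |∇u|²`. -/
def dirichlet (u : H10 N Ω) : ℝ := ∫ x in Ω, ‖grad u x‖ ^ 2

/-- The norm `‖(u, v)‖_H = (∫_Ω |∇u|² + ∫_Ω |∇v|²)^{1/2}` on `W = H¹₀(Ω) × H¹₀(Ω)`. -/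
def normH (w : H10 N Ω × H10 N Ω) : ℝ := Real.sqrt (dirichlet w.1 + dirichlet w.2)

/-- The energy functional `J_λ` of the system on `W = H¹₀(Ω) × H¹₀(Ω)`. -/
def J (a b : E N → ℝ) (q α β lam : ℝ) (w : H10 N Ω × H10 N Ω) : ℝ :=
  1 / 2 * normH w ^ 2
    - 1 / q * (lam * ((∫ x in Ω, a x * |fn w.1 x| ^ q) + ∫ x in Ω, a x * |fn w.2 x| ^ q))
    - 1 / (α + β) * ∫ x in Ω, b x * |fn w.1 x| ^ α * |fn w.2 x| ^ β

/-- The Nehari manifold `{w ∈ W : ⟨J_λ'(w), w⟩ = 0}`; the pairing is the derivative of `J_λ` at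
`w` in the direction `w`. -/
def nehari (Ω : Set (E N)) (a b : E N → ℝ) (q α β lam : ℝ) : Set (H10 N Ω × H10 N Ω) :=
  {w | lineDeriv ℝ (J a b q α β lam) w w = 0}

/-- With a Fréchet derivative `L = J_λ'(w)`, the defining condition reads `L w = 0`. -/
theorem mem_nehari_iff_of_hasFDerivAt {a b : E N → ℝ} {q α β lam : ℝ} {w : H10 N Ω × H10 N Ω}
    {L : (H10 N Ω × H10 N Ω) →L[ℝ] ℝ} (hL : HasFDerivAt (J a b q α β lam) L w) :
    w ∈ nehari Ω a b q α β lam ↔ L w = 0 := by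
  rw [nehari, Set.mem_ofPred_eq, (hL.hasLineDerivAt w).lineDeriv]

/-- `F` is coercive on `M`: `F(w) → ∞` as `‖w‖_H → ∞` with `w ∈ M`. -/
def CoerciveOn (F : H10 N Ω × H10 N Ω → ℝ) (M : Set (H10 N Ω × H10 N Ω)) : Prop :=
  ∀ R : ℝ, ∃ ρ : ℝ, ∀ w ∈ M, ρ ≤ normH w → R ≤ F w

/-- The norm of the embedding of `H¹₀(Ω)`, normed by `(∫_Ω |∇u|²)^{1/2}`, in `L^γ(Ω)`: the least
`C` with `‖u‖_{L^γ} ≤ C (∫_Ω |∇u|²)^{1/2}` for all `u`. -/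
def sobolevConst (Ω : Set (E N)) (γ : ℝ) : ℝ :=
  sInf {C : ℝ | 0 ≤ C ∧ ∀ u : H10 N Ω,
    eLpNorm (fn u) (ENNReal.ofReal γ) ((volume : Measure (E N)).restrict Ω) ≤
      ENNReal.ofReal (C * Real.sqrt (dirichlet u))}

/-- `‖a‖_{L^r(Ω)}`. -/
def normL (Ω : Set (E N)) (a : E N → ℝ) (r : ℝ) : ℝ :=
  (eLpNorm a (ENNReal.ofReal r) ((volume : Measure (E N)).restrict Ω)).toReal

end LaplacianSystem

end

/-! Write p = α + β. On the Nehari manifold the b-term equals the quadratic term minus the a-term,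
so it can be eliminated, leaving J = (1/2 - 1/p)‖w‖² - (1/q - 1/p) λ ∫ a(|u|^q + |v|^q). Hölder's
inequality and the embedding in L^p bound each a-integral by ‖a‖_r S^q ‖∇u‖^q
(`le_J_of_mem_nehari`). Hence J is at least a sum of two expressions c x² - d x^q, with x the L²
norm of one gradient. Since q < 2, each has a finite minimum (`min_le_mul_sq_sub_mul_rpow`), which
is the stated constant, and the quadratic term gives coercivity. The analytic input is that S is a
genuine embedding constant: `eLpNorm_le_sobolevConst_mul` rests on a Poincaré–Sobolev inequality for
test functions, extended to their closure. -/

noncomputable section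

namespace LaplacianSystem

/-! ### Scalar inequalities -/

/-- The minimum over `x ≥ 0` of `c x² - d x^q` for `q < 2`. -/
theorem min_le_mul_sq_sub_mul_rpow {c d q x : ℝ} (hc : 0 < c) (hd : 0 ≤ d) (hq0 : 0 < q)
    (hq2 : q < 2) (hx : 0 ≤ x) :
    c * (1 - 2 / q) * (q * d / (2 * c)) ^ (2 / (2 - q)) ≤ c * x ^ 2 - d * x ^ q := by
  have h2q : 0 < 2 - q := by linarith
  -- The minimizer satisfies x^(2 - q) = y, so AM-GM between x² and y^(2 / (2 - q)) is sharp there.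
  set y := q * d / (2 * c) with hy
  have hy0 : 0 ≤ y := by positivity
  have hdy : d = 2 * c / q * y := by rw [hy]; field_simp
  have h := Real.geom_mean_le_arith_mean2_weighted (w₁ := q / 2) (w₂ := 1 - q / 2)
    (by positivity) (by linarith) (sq_nonneg x) (Real.rpow_nonneg hy0 (2 / (2 - q))) (by ring)
  have e1 : (x ^ 2) ^ (q / 2) = x ^ q := by
    rw [← Real.rpow_natCast, ← Real.rpow_mul hx]
    congr 1
    push_cast
    ring
  have e2 : (y ^ (2 / (2 - q))) ^ (1 - q / 2) = y := by
    rw [← Real.rpow_mul hy0]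
    convert Real.rpow_one y using 2
    field_simp
  rw [e1, e2] at h
  have h' := mul_le_mul_of_nonneg_left h (show 0 ≤ 2 * c / q by positivity)
  have e3 : 2 * c / q * (q / 2 * x ^ 2 + (1 - q / 2) * y ^ (2 / (2 - q))) =
      c * x ^ 2 - c * (1 - 2 / q) * y ^ (2 / (2 - q)) := by
    field_simp
    ring
  rw [e3] at h'
  rw [hdy]
  linarith

/-- Evaluates the scalar minimum at c = 1/2 - 1/p and d = (1/q - 1/p) k S^q. The factor p - 2 in c
cancels one power, as 2 / (2 - q) = 1 + q / (2 - q). -/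
theorem young_constant_eq {p q k S : ℝ} (hq0 : 0 < q) (hq2 : q < 2) (hp : 2 < p) (hk : 0 ≤ k)
    (hS : 0 ≤ S) :
    (p - 2) / (2 * p) * (1 - 2 / q) *
        (q * ((p - q) / (p * q) * (k * S ^ q)) / (2 * ((p - 2) / (2 * p)))) ^ (2 / (2 - q)) =
      S ^ (2 * q / (2 - q)) * (q - 2) * (p - q) ^ (2 / (2 - q))
          / (2 * q * p * (p - 2) ^ (q / (2 - q))) * k ^ (2 / (2 - q)) := by
  have h2q : 0 < 2 - q := by linarith
  have hp2 : 0 < p - 2 := by linarith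
  have hpq : 0 < p - q := by linarith
  have hp0 : 0 < p := by linarith
  have e1 : q * ((p - q) / (p * q) * (k * S ^ q)) / (2 * ((p - 2) / (2 * p))) =
      (p - q) * (k * S ^ q) / (p - 2) := by
    field_simp
  have e2 : (S ^ q) ^ (2 / (2 - q)) = S ^ (2 * q / (2 - q)) := by
    rw [← Real.rpow_mul hS]
    congr 1
    ring
  have e3 : (p - 2) ^ (2 / (2 - q)) = (p - 2) * (p - 2) ^ (q / (2 - q)) := by
    rw [← Real.rpow_one_add' hp2.le (by positivity)]
    congr 1
    field_simp
    ring
  have hSq : 0 ≤ S ^ q := Real.rpow_nonneg hS q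
  have h3 : 0 < (p - 2) ^ (q / (2 - q)) := Real.rpow_pos_of_pos hp2 _
  rw [e1, Real.div_rpow (by positivity) hp2.le, Real.mul_rpow hpq.le (by positivity),
    Real.mul_rpow hk hSq, e2, e3]
  field_simp

/-! ### Poincaré–Sobolev inequality for test functions -/

/-- The fundamental theorem of calculus from -∞, transported to `E 1` by a volume-preserving linear
isometry. -/
theorem enorm_le_lintegral_enorm_fderiv {φ : E 1 → ℝ} (hφ : ContDiff ℝ 1 φ)
    (hc : HasCompactSupport φ) (x : E 1) : ‖φ x‖ₑ ≤ ∫⁻ y, ‖fderiv ℝ φ y‖ₑ := by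
  let e : ℝ ≃ₗᵢ[ℝ] E 1 := (stdOrthonormalBasis ℝ ℝ).repr.trans
    (LinearIsometryEquiv.piLpCongrLeft 2 ℝ ℝ (finCongr (Module.finrank_self ℝ)))
  have he : HasCompactSupport (φ ∘ e) :=
    hc.comp_isClosedEmbedding e.toHomeomorph.isClosedEmbedding
  have hd : ∀ t, ‖deriv (φ ∘ e) t‖ₑ ≤ ‖fderiv ℝ φ (e t)‖ₑ := fun t => by
    have h1 : HasDerivAt (φ ∘ e) (fderiv ℝ φ (e t) (e 1)) t := by
      have h2 := (hφ.differentiable (by simp) (e t)).hasFDerivAt.comp_hasDerivAt t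
        (e.toContinuousLinearEquiv.toContinuousLinearMap.hasDerivAt (x := t))
      exact h2
    rw [h1.deriv, ← ofReal_norm, ← ofReal_norm]
    refine ENNReal.ofReal_le_ofReal ?_
    refine (ContinuousLinearMap.le_opNorm _ _).trans ?_
    simp
  calc ‖φ x‖ₑ = ‖(φ ∘ e) (e.symm x)‖ₑ := by simp
    _ ≤ ∫⁻ t in Set.Iic (e.symm x), ‖deriv (φ ∘ e) t‖ₑ :=
        he.enorm_le_lintegral_Ici_deriv (hφ.comp e.contDiff) _
    _ ≤ ∫⁻ t, ‖deriv (φ ∘ e) t‖ₑ := setLIntegral_le_lintegral _ _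
    _ ≤ ∫⁻ t, ‖fderiv ℝ φ (e t)‖ₑ := lintegral_mono hd
    _ = ∫⁻ y, ‖fderiv ℝ φ y‖ₑ :=
        e.measurePreserving.lintegral_comp_emb e.toHomeomorph.measurableEmbedding
          (fun y => ‖fderiv ℝ φ y‖ₑ)

variable {N : ℕ} {Ω : Set (E N)}

theorem IsTest.support_subset {φ : E N → ℝ} (h : IsTest Ω φ) : Function.support φ ⊆ Ω :=
  (subset_tsupport φ).trans h.2.2

theorem IsTest.support_fderiv_subset {φ : E N → ℝ} (h : IsTest Ω φ) :
    Function.support (fderiv ℝ φ) ⊆ Ω :=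
  (_root_.support_fderiv_subset ℝ).trans h.2.2

theorem IsTest.eLpNorm_fderiv_restrict {φ : E N → ℝ} (h : IsTest Ω φ) (p : ENNReal) :
    eLpNorm (fderiv ℝ φ) p (volume.restrict Ω) = eLpNorm (fderiv ℝ φ) p volume := by
  rw [← eLpNorm_norm, ← eLpNorm_norm (fderiv ℝ φ)]
  refine eLpNorm_restrict_eq_of_support_subset ?_
  simpa only [Function.support, ne_eq, norm_eq_zero] using h.support_fderiv_subset

theorem eLpNorm_gradient (φ : E N → ℝ) (p : ENNReal) (μ : Measure (E N)) :
    eLpNorm (gradient φ) p μ = eLpNorm (fderiv ℝ φ) p μ :=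
  eLpNorm_congr_norm_ae (.of_forall fun x => by simp [gradient])

/-- Poincaré–Sobolev inequality for test functions, with a gradient exponent at most `2`. -/
theorem exists_eLpNorm_le_eLpNorm_fderiv (hN : 1 ≤ N) (hΩb : Bornology.IsBounded Ω) {γ : ℝ}
    (hγ : 2 < γ) (hcrit : 3 ≤ N → γ < 2 * (N : ℝ) / ((N : ℝ) - 2)) :
    ∃ (p : ENNReal) (C : ENNReal), p ≤ 2 ∧ C ≠ ⊤ ∧ 1 ≤ p ∧ ∀ φ : E N → ℝ, IsTest Ω φ →
      eLpNorm φ (ENNReal.ofReal γ) (volume.restrict Ω) ≤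
        C * eLpNorm (fderiv ℝ φ) p (volume.restrict Ω) := by
  have hvol : volume Ω ≠ ⊤ := hΩb.measure_lt_top.ne
  obtain rfl | hN2 := hN.eq_or_lt
  · refine ⟨1, volume Ω ^ (1 / (ENNReal.ofReal γ).toReal - 1 / (⊤ : ENNReal).toReal), by simp,
      ENNReal.rpow_ne_top_of_nonneg (by simp) hvol, le_rfl, fun φ hφ => ?_⟩
    have h1 : ContDiff ℝ 1 φ := hφ.1.of_le (by exact_mod_cast le_top)
    have h2 := eLpNorm_le_eLpNorm_mul_rpow_measure_univ (μ := (volume : Measure (E 1)).restrict Ω)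
      (f := φ) (p := ENNReal.ofReal γ) le_top h1.continuous.aestronglyMeasurable
    rw [Measure.restrict_apply_univ] at h2
    rw [mul_comm]
    refine h2.trans (mul_le_mul_left ?_ _)
    rw [hφ.eLpNorm_fderiv_restrict, eLpNorm_exponent_top,
      eLpNorm_one_eq_lintegral_enorm]
    exact essSup_le_of_ae_le _ (.of_forall fun x => enorm_le_lintegral_enorm_fderiv h1 hφ.2.1 x)
  -- The Gagliardo–Nirenberg–Sobolev inequality needs p < N strictly, so p = 2 works only for N ≥ 3.
  · obtain ⟨p, hp1, hp2, hpN, hpγ⟩ : ∃ p : ℝ, 1 ≤ p ∧ p ≤ 2 ∧ p < N ∧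
        p⁻¹ - (N : ℝ)⁻¹ ≤ γ⁻¹ := by
      obtain rfl | hN3 := (show 2 ≤ N from hN2).eq_or_lt
      · have hγ' : γ⁻¹ < 2⁻¹ := by gcongr
        have hγ0 : 0 < γ⁻¹ := by positivity
        -- For N = 2 this p gives equality in p⁻¹ - N⁻¹ ≤ γ⁻¹; γ > 2 makes it at least 1.
        refine ⟨(2⁻¹ + γ⁻¹)⁻¹, ?_, ?_, ?_, ?_⟩
        · rw [one_le_inv₀ (by positivity)]; linarith
        · rw [inv_le_comm₀ (by positivity) (by positivity)]; linarith
        · push_cast; rw [inv_lt_comm₀ (by positivity) (by positivity)]; linarith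
        · push_cast; rw [inv_inv]; linarith
      · have hN3' : (3 : ℝ) ≤ N := by exact_mod_cast hN3
        refine ⟨2, by norm_num, le_rfl, by linarith, ?_⟩
        have h := hcrit hN3
        have h' : (2 * (N : ℝ) / ((N : ℝ) - 2))⁻¹ ≤ γ⁻¹ := by gcongr
        refine le_trans (le_of_eq ?_) h'
        have : (N : ℝ) - 2 ≠ 0 := by linarith
        field_simp
    refine ⟨ENNReal.ofReal p, eLpNormLESNormFDerivOfLeConst ℝ (volume : Measure (E N)) Ω p.toNNReal
      γ.toNNReal, by simpa using ENNReal.ofReal_le_ofReal hp2, ENNReal.coe_ne_top,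
      by simpa using ENNReal.ofReal_le_ofReal hp1, fun φ hφ => ?_⟩
    rw [hφ.eLpNorm_fderiv_restrict,
      eLpNorm_restrict_eq_of_support_subset hφ.support_subset]
    refine eLpNorm_le_eLpNorm_fderiv_of_le volume (hφ.1.of_le (by exact_mod_cast le_top))
      hφ.support_subset ?_ ?_ ?_ hΩb
    · simpa using hp1
    · rw [finrank_euclideanSpace_fin, ← NNReal.coe_lt_coe]
      simpa [Real.coe_toNNReal p (by linarith)] using hpN
    · rw [finrank_euclideanSpace_fin]
      simpa [Real.coe_toNNReal p (by linarith), Real.coe_toNNReal γ (by linarith)] using hpγ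

/-- Poincaré–Sobolev inequality for test functions. -/
theorem exists_eLpNorm_le_eLpNorm_gradient (hN : 1 ≤ N) (hΩb : Bornology.IsBounded Ω) {γ : ℝ}
    (hγ : 2 < γ) (hcrit : 3 ≤ N → γ < 2 * (N : ℝ) / ((N : ℝ) - 2)) :
    ∃ C : ENNReal, C ≠ ⊤ ∧ ∀ φ : E N → ℝ, IsTest Ω φ →
      eLpNorm φ (ENNReal.ofReal γ) (volume.restrict Ω) ≤
        C * eLpNorm (gradient φ) 2 (volume.restrict Ω) := by
  obtain ⟨p, C, hp2, hC, hp1, h⟩ := exists_eLpNorm_le_eLpNorm_fderiv hN hΩb hγ hcrit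
  have hvol : volume Ω ≠ ⊤ := hΩb.measure_lt_top.ne
  have hp0 : 0 < p.toReal :=
    ENNReal.toReal_pos (zero_lt_one.trans_le hp1).ne' (hp2.trans_lt (by simp)).ne
  have hexp : 0 ≤ 1 / p.toReal - 1 / (2 : ENNReal).toReal :=
    sub_nonneg.2 (one_div_le_one_div_of_le hp0 (ENNReal.toReal_mono (by simp) hp2))
  refine ⟨C * volume Ω ^ (1 / p.toReal - 1 / (2 : ENNReal).toReal),
    ENNReal.mul_ne_top hC (ENNReal.rpow_ne_top_of_nonneg hexp hvol), fun φ hφ => ?_⟩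
  have h1 : ContDiff ℝ 1 φ := hφ.1.of_le (by exact_mod_cast le_top)
  have h2 := eLpNorm_le_eLpNorm_mul_rpow_measure_univ (μ := (volume : Measure (E N)).restrict Ω)
    (f := fderiv ℝ φ) hp2 (h1.continuous_fderiv (by simp)).aestronglyMeasurable
  rw [Measure.restrict_apply_univ] at h2
  rw [eLpNorm_gradient, mul_assoc, mul_comm (volume Ω ^ _)]
  exact (h φ hφ).trans (mul_le_mul_right h2 _)

/-! ### The embedding constant on H¹₀(Ω) -/

theorem dirichlet_eq_norm_sq (u : H10 N Ω) : dirichlet u = ‖u.1.2‖ ^ 2 := by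
  rw [← real_inner_self_eq_norm_sq, L2.inner_def]
  simp [dirichlet, grad]

theorem sqrt_dirichlet (u : H10 N Ω) : Real.sqrt (dirichlet u) = ‖u.1.2‖ := by
  rw [dirichlet_eq_norm_sq, Real.sqrt_sq (norm_nonneg _)]

theorem dirichlet_nonneg (u : H10 N Ω) : 0 ≤ dirichlet u := by
  rw [dirichlet_eq_norm_sq]; positivity

theorem dirichlet_smul (s : ℝ) (u : H10 N Ω) : dirichlet (s • u) = s ^ 2 * dirichlet u := by
  simp [dirichlet_eq_norm_sq, norm_smul, mul_pow]

/-- Poincaré–Sobolev inequality in `H¹₀(Ω)`. -/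
theorem exists_eLpNorm_le_dirichlet (hN : 1 ≤ N) (hΩb : Bornology.IsBounded Ω) {γ : ℝ}
    (hγ : 2 < γ) (hcrit : 3 ≤ N → γ < 2 * (N : ℝ) / ((N : ℝ) - 2)) :
    ∃ C : ℝ, 0 ≤ C ∧ ∀ u : H10 N Ω,
      eLpNorm (fn u) (ENNReal.ofReal γ) (volume.restrict Ω) ≤
        ENNReal.ofReal (C * Real.sqrt (dirichlet u)) := by
  obtain ⟨C, hC, h⟩ := exists_eLpNorm_le_eLpNorm_gradient hN hΩb hγ hcrit
  refine ⟨C.toReal, ENNReal.toReal_nonneg, fun u => ?_⟩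
  obtain ⟨w, hw, hlim⟩ := mem_closure_iff_seq_limit.1 (show u.1 ∈ closure _ from u.2)
  have hb : ∀ n, eLpNorm (w n).1 (ENNReal.ofReal γ) (volume.restrict Ω) ≤
      ENNReal.ofReal (C.toReal * ‖(w n).2‖) := fun n => by
    obtain ⟨φ, hφ, h1, h2⟩ := hw n
    rw [ENNReal.ofReal_mul ENNReal.toReal_nonneg, ENNReal.ofReal_toReal hC, Lp.norm_def,
      ENNReal.ofReal_toReal (Lp.eLpNorm_ne_top _), eLpNorm_congr_ae h1, eLpNorm_congr_ae h2]
    exact h φ hφ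
  have h1 : Filter.Tendsto (fun n => (w n).1) Filter.atTop (nhds u.1.1) :=
    (continuous_fst.tendsto _).comp hlim
  have h2 : Filter.Tendsto (fun n => C.toReal * ‖(w n).2‖) Filter.atTop
      (nhds (C.toReal * ‖u.1.2‖)) :=
    (((continuous_snd.tendsto _).comp hlim).norm).const_mul _
  rw [sqrt_dirichlet]
  -- L² convergence gives convergence in measure, under which the L^γ norm is lower semicontinuous
  -- (Fatou); no convergence in L^γ is needed.
  refine le_of_forall_gt_imp_ge_of_dense fun c hc => ?_
  have h3 : ∀ᶠ n in Filter.atTop, ENNReal.ofReal (C.toReal * ‖(w n).2‖) < c :=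
    ((ENNReal.continuous_ofReal.tendsto _).comp h2).eventually_lt_const hc
  exact eLpNorm_le_of_tendstoInMeasure (h3.mono fun n hn => (hb n).trans hn.le)
    (tendstoInMeasure_of_tendsto_Lp h1) fun n => (Lp.aestronglyMeasurable _)

theorem sobolevConst_nonneg (Ω : Set (E N)) (γ : ℝ) : 0 ≤ sobolevConst Ω γ :=
  Real.sInf_nonneg fun _ h => h.1

/-- The infimum in the definition of the embedding constant is attained. -/
theorem eLpNorm_le_sobolevConst_mul (hN : 1 ≤ N) (hΩb : Bornology.IsBounded Ω) {γ : ℝ}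
    (hγ : 2 < γ) (hcrit : 3 ≤ N → γ < 2 * (N : ℝ) / ((N : ℝ) - 2)) (u : H10 N Ω) :
    eLpNorm (fn u) (ENNReal.ofReal γ) (volume.restrict Ω) ≤
      ENNReal.ofReal (sobolevConst Ω γ * Real.sqrt (dirichlet u)) := by
  obtain ⟨C₀, hC₀, h₀⟩ := exists_eLpNorm_le_dirichlet hN hΩb hγ hcrit
  rcases (Real.sqrt_nonneg (dirichlet u)).eq_or_lt with h | h
  · simpa [← h] using h₀ u
  have hfin : eLpNorm (fn u) (ENNReal.ofReal γ) (volume.restrict Ω) ≠ ⊤ :=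
    ((h₀ u).trans_lt ENNReal.ofReal_lt_top).ne
  rw [← ENNReal.ofReal_toReal hfin]
  refine ENNReal.ofReal_le_ofReal ?_
  rw [← div_le_iff₀ h]
  -- `C₀` shows that the set of admissible constants is nonempty, so the infimum is not the default
  -- value 0.
  refine le_csInf ⟨C₀, hC₀, h₀⟩ fun C hC => ?_
  rw [div_le_iff₀ h]
  exact ENNReal.toReal_le_of_le_ofReal (mul_nonneg hC.1 h.le) (hC.2 u)

/-! ### Rays and the Nehari equation -/

theorem fn_smul (s : ℝ) (u : H10 N Ω) :
    fn (s • u) =ᵐ[volume.restrict Ω] fun x => s * fn u x :=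
  Lp.coeFn_smul s u.1.1

theorem normH_sq (w : H10 N Ω × H10 N Ω) : normH w ^ 2 = dirichlet w.1 + dirichlet w.2 :=
  Real.sq_sqrt (add_nonneg (dirichlet_nonneg _) (dirichlet_nonneg _))

/-- The energy along the ray through `w`. -/
theorem J_smul (a b : E N → ℝ) {q α β : ℝ} (lam : ℝ) {s : ℝ}
    (hs : 0 < s) (w : H10 N Ω × H10 N Ω) :
    J a b q α β lam (s • w) =
      1 / 2 * (s ^ 2 * normH w ^ 2)
      - 1 / q * (s ^ q * (lam * ((∫ x in Ω, a x * |fn w.1 x| ^ q) +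
          ∫ x in Ω, a x * |fn w.2 x| ^ q)))
      - 1 / (α + β) * (s ^ (α + β) * ∫ x in Ω, b x * |fn w.1 x| ^ α * |fn w.2 x| ^ β) := by
  have hA : normH (s • w) ^ 2 = s ^ 2 * normH w ^ 2 := by
    rw [normH_sq, normH_sq, Prod.smul_fst, Prod.smul_snd, dirichlet_smul, dirichlet_smul]
    ring
  have hB : ∀ u : H10 N Ω, ∫ x in Ω, a x * |fn (s • u) x| ^ q =
      s ^ q * ∫ x in Ω, a x * |fn u x| ^ q := fun u => by
    -- Pulling out the constant is valid even without integrability.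
    rw [← integral_const_mul]
    refine integral_congr_ae ?_
    filter_upwards [fn_smul s u] with x hx
    rw [hx, abs_mul, abs_of_pos hs, Real.mul_rpow hs.le (abs_nonneg _)]
    ring
  have hC : ∫ x in Ω, b x * |fn (s • w.1) x| ^ α * |fn (s • w.2) x| ^ β =
      s ^ (α + β) * ∫ x in Ω, b x * |fn w.1 x| ^ α * |fn w.2 x| ^ β := by
    rw [← integral_const_mul]
    refine integral_congr_ae ?_
    filter_upwards [fn_smul s w.1, fn_smul s w.2] with x hx hx'
    rw [hx, hx', abs_mul, abs_mul, abs_of_pos hs, Real.mul_rpow hs.le (abs_nonneg _),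
      Real.mul_rpow hs.le (abs_nonneg _), Real.rpow_add hs]
    ring
  simp only [J, hA, Prod.smul_fst, Prod.smul_snd, hB w.1, hB w.2, hC]
  ring

/-- Along w + t w = (1 + t) w the energy is a combination of powers of 1 + t, differentiable at t =
0. So the line derivative exists, and the condition never holds merely through the default value 0
of `lineDeriv`. -/
theorem mem_nehari_iff (a b : E N → ℝ) {q α β : ℝ} (lam : ℝ) (hq : q ≠ 0) (hα : 0 < α)
    (hβ : 0 < β) (w : H10 N Ω × H10 N Ω) :
    w ∈ nehari Ω a b q α β lam ↔
      normH w ^ 2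
        - lam * ((∫ x in Ω, a x * |fn w.1 x| ^ q) + ∫ x in Ω, a x * |fn w.2 x| ^ q)
        - ∫ x in Ω, b x * |fn w.1 x| ^ α * |fn w.2 x| ^ β = 0 := by
  set A := normH w ^ 2
  set B := lam * ((∫ x in Ω, a x * |fn w.1 x| ^ q) + ∫ x in Ω, a x * |fn w.2 x| ^ q)
  set C := ∫ x in Ω, b x * |fn w.1 x| ^ α * |fn w.2 x| ^ β
  have hαβ : α + β ≠ 0 := by positivity
  have hpow : ∀ r : ℝ, HasDerivAt (fun t : ℝ => (1 + t) ^ r) r 0 := fun r => by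
    have h := ((hasDerivAt_id (0 : ℝ)).const_add 1).rpow_const (p := r) (by simp)
    simpa using h
  have hsq : HasDerivAt (fun t : ℝ => (1 + t) ^ 2) 2 0 := by
    simpa using hasDerivAt_pow 2 (1 + 0 : ℝ) |>.comp_const_add 1 0
  have hd : HasDerivAt (fun t : ℝ => 1 / 2 * ((1 + t) ^ 2 * A) - 1 / q * ((1 + t) ^ q * B)
      - 1 / (α + β) * ((1 + t) ^ (α + β) * C)) (A - B - C) 0 := by
    convert! (((hsq.mul_const A).const_mul (1 / 2)).sub
      (((hpow q).mul_const B).const_mul (1 / q))).sub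
      (((hpow (α + β)).mul_const C).const_mul (1 / (α + β))) using 1
    field_simp
  have hl : HasLineDerivAt ℝ (J a b q α β lam) (A - B - C) w w := by
    refine hd.congr_of_eventuallyEq ?_
    filter_upwards [Ioi_mem_nhds (show (-1 : ℝ) < 0 by norm_num)] with t ht
    have ht' : 0 < 1 + t := by linarith [Set.mem_Ioi.1 ht]
    have h1 : w + t • w = (1 + t) • w := by rw [add_smul, one_smul]
    rw [h1]
    exact J_smul a b lam ht' w
  rw [nehari, Set.mem_ofPred_eq, hl.lineDeriv]

/-! ### Lower bound and coercivity on the Nehari manifold -/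

theorem aestronglyMeasurable_fn (u : H10 N Ω) :
    AEStronglyMeasurable (fn u) (volume.restrict Ω) :=
  Lp.aestronglyMeasurable u.1.1

theorem eLpNorm_ne_top_of_continuousOn_closure (hΩ : IsOpen Ω) (hΩb : Bornology.IsBounded Ω)
    {a : E N → ℝ} (ha : ContinuousOn a (closure Ω)) (r : ENNReal) :
    eLpNorm a r (volume.restrict Ω) ≠ ⊤ := by
  have : IsFiniteMeasure ((volume : Measure (E N)).restrict Ω) :=
    isFiniteMeasure_restrict.2 hΩb.measure_lt_top.ne
  obtain ⟨K, hK⟩ := hΩb.isCompact_closure.exists_bound_of_continuousOn ha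
  have hm : AEStronglyMeasurable a (volume.restrict Ω) :=
    (ha.mono subset_closure).aestronglyMeasurable hΩ.measurableSet
  exact (MemLp.of_bound hm K ((ae_restrict_mem hΩ.measurableSet).mono fun x hx =>
    hK x (subset_closure hx))).eLpNorm_ne_top

/-- Hölder's inequality for `∫ a |u|^q` with exponents `p / (p - q)` and `p / q`. -/
theorem abs_integral_mul_rpow_le (hΩ : IsOpen Ω) (hΩb : Bornology.IsBounded Ω)
    {a : E N → ℝ} (ha : ContinuousOn a (closure Ω)) {p q : ℝ} (hq : 0 < q) (hqp : q < p)
    (u : H10 N Ω) {M : ℝ} (hM : 0 ≤ M)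
    (hu : eLpNorm (fn u) (ENNReal.ofReal p) (volume.restrict Ω) ≤ ENNReal.ofReal M) :
    |∫ x in Ω, a x * |fn u x| ^ q| ≤ normL Ω a (p / (p - q)) * M ^ q := by
  have hp : 0 < p := hq.trans hqp
  have hpq : 0 < p - q := by linarith
  have hm : AEStronglyMeasurable a (volume.restrict Ω) :=
    (ha.mono subset_closure).aestronglyMeasurable hΩ.measurableSet
  have hfin := eLpNorm_ne_top_of_continuousOn_closure hΩ hΩb ha (ENNReal.ofReal (p / (p - q)))
  have hm' : AEStronglyMeasurable (fun x => ‖fn u x‖ ^ q) (volume.restrict Ω) :=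
    ((aestronglyMeasurable_fn u).norm.aemeasurable.pow_const q).aestronglyMeasurable
  have : ENNReal.HolderTriple (ENNReal.ofReal (p / (p - q))) (ENNReal.ofReal (p / q)) 1 := by
    refine ⟨?_⟩
    rw [← ENNReal.ofReal_inv_of_pos (by positivity), ← ENNReal.ofReal_inv_of_pos (by positivity),
      ← ENNReal.ofReal_add (by positivity) (by positivity), inv_one, ← ENNReal.ofReal_one]
    congr 1
    field_simp
    ring
  have h1 := eLpNorm_smul_le_mul_eLpNorm (p := ENNReal.ofReal (p / (p - q)))
    (q := ENNReal.ofReal (p / q)) (r := 1) hm' hm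
  have e : ENNReal.ofReal (p / q) * ENNReal.ofReal q = ENNReal.ofReal p := by
    rw [← ENNReal.ofReal_mul (by positivity)]
    congr 1
    field_simp
  rw [eLpNorm_norm_rpow _ hq, e, eLpNorm_one_eq_lintegral_enorm] at h1
  have h2 : ‖∫ x in Ω, a x * |fn u x| ^ q‖ₑ ≤
      eLpNorm a (ENNReal.ofReal (p / (p - q))) (volume.restrict Ω) * ENNReal.ofReal M ^ q :=
    ((enorm_integral_le_lintegral_enorm _).trans h1).trans (by gcongr)
  have h3 := ENNReal.toReal_mono (ENNReal.mul_ne_top hfin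
    (ENNReal.rpow_ne_top_of_nonneg hq.le ENNReal.ofReal_ne_top)) h2
  simpa [ENNReal.toReal_mul, ← ENNReal.toReal_rpow, ENNReal.toReal_ofReal hM, normL] using h3

/-- On the Nehari manifold the energy is bounded below in terms of the Dirichlet norms alone. -/
theorem le_J_of_mem_nehari (hN : 1 ≤ N) (hΩ : IsOpen Ω) (hΩb : Bornology.IsBounded Ω)
    {a b : E N → ℝ} (ha : ContinuousOn a (closure Ω)) {q α β lam : ℝ} (hq0 : 0 < q) (hq2 : q < 2)
    (hα : 0 < α) (hβ : 0 < β) (hp : 2 < α + β)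
    (hcrit : 3 ≤ N → α + β < 2 * (N : ℝ) / ((N : ℝ) - 2)) {w : H10 N Ω × H10 N Ω}
    (hw : w ∈ nehari Ω a b q α β lam) :
    ((α + β - 2) / (2 * (α + β)) * ‖w.1.1.2‖ ^ 2 - (α + β - q) / ((α + β) * q) *
        (|lam| * normL Ω a ((α + β) / (α + β - q)) * sobolevConst Ω (α + β) ^ q) *
          ‖w.1.1.2‖ ^ q) +
      ((α + β - 2) / (2 * (α + β)) * ‖w.2.1.2‖ ^ 2 - (α + β - q) / ((α + β) * q) *
        (|lam| * normL Ω a ((α + β) / (α + β - q)) * sobolevConst Ω (α + β) ^ q) *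
          ‖w.2.1.2‖ ^ q) ≤ J a b q α β lam w := by
  have hp0 : 0 < α + β := by linarith
  have hpq : 0 < α + β - q := by linarith
  have hS := sobolevConst_nonneg Ω (α + β)
  have hbound : ∀ u : H10 N Ω, |∫ x in Ω, a x * |fn u x| ^ q| ≤
      normL Ω a ((α + β) / (α + β - q)) * (sobolevConst Ω (α + β) ^ q * ‖u.1.2‖ ^ q) := fun u => by
    rw [← Real.mul_rpow hS (norm_nonneg _), ← sqrt_dirichlet]
    exact abs_integral_mul_rpow_le hΩ hΩb ha hq0 (by linarith) u
      (mul_nonneg hS (Real.sqrt_nonneg _)) (eLpNorm_le_sobolevConst_mul hN hΩb hp hcrit u)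
  have h0 := (mem_nehari_iff a b lam hq0.ne' hα hβ w).1 hw
  have hA : normH w ^ 2 = ‖w.1.1.2‖ ^ 2 + ‖w.2.1.2‖ ^ 2 := by
    rw [normH_sq, dirichlet_eq_norm_sq, dirichlet_eq_norm_sq]
  have h1 := hbound w.1
  have h2 := hbound w.2
  rw [J]
  set I₁ := ∫ x in Ω, a x * |fn w.1 x| ^ q
  set I₂ := ∫ x in Ω, a x * |fn w.2 x| ^ q
  set K := ∫ x in Ω, b x * |fn w.1 x| ^ α * |fn w.2 x| ^ β
  -- The Nehari equation removes the b-integral, whose sign is unknown.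
  have hK : K = normH w ^ 2 - lam * (I₁ + I₂) := by linarith
  have h3 : lam * (I₁ + I₂) ≤ |lam| * (|I₁| + |I₂|) :=
    (le_abs_self _).trans (by rw [abs_mul]; gcongr; exact abs_add_le _ _)
  have h4 := h3.trans (mul_le_mul_of_nonneg_left (add_le_add h1 h2) (abs_nonneg lam))
  have h5 := mul_le_mul_of_nonneg_left h4
    (show 0 ≤ (α + β - q) / ((α + β) * q) by positivity)
  have e : 1 / 2 * normH w ^ 2 - 1 / q * (lam * (I₁ + I₂)) - 1 / (α + β) * K =
      (α + β - 2) / (2 * (α + β)) * normH w ^ 2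
        - (α + β - q) / ((α + β) * q) * (lam * (I₁ + I₂)) := by
    rw [hK]
    field_simp
    ring
  rw [e, hA]
  refine le_trans (le_of_eq ?_) (sub_le_sub_left h5 _)
  ring

/-- Half of each quadratic term absorbs the q-th power at the cost of a constant `m`; the other
halves leave F ≥ (c/2)‖w‖² + 2m. -/
theorem coerciveOn_of_le {F : H10 N Ω × H10 N Ω → ℝ} {M : Set (H10 N Ω × H10 N Ω)}
    {c d q : ℝ} (hc : 0 < c) (hd : 0 ≤ d) (hq0 : 0 < q) (hq2 : q < 2)
    (hF : ∀ w ∈ M, (c * ‖w.1.1.2‖ ^ 2 - d * ‖w.1.1.2‖ ^ q) +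
      (c * ‖w.2.1.2‖ ^ 2 - d * ‖w.2.1.2‖ ^ q) ≤ F w) : CoerciveOn F M := by
  intro R
  set m := c / 2 * (1 - 2 / q) * (q * d / (2 * (c / 2))) ^ (2 / (2 - q))
  have hlim : Filter.Tendsto (fun t : ℝ => c / 2 * t ^ 2) Filter.atTop Filter.atTop :=
    (Filter.tendsto_pow_atTop two_ne_zero).const_mul_atTop (half_pos hc)
  obtain ⟨ρ, hρ⟩ := Filter.eventually_atTop.1 (hlim.eventually_ge_atTop (R - 2 * m))
  refine ⟨ρ, fun w hw hle => ?_⟩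
  have h1 := min_le_mul_sq_sub_mul_rpow (half_pos hc) hd hq0 hq2 (norm_nonneg w.1.1.2)
  have h2 := min_le_mul_sq_sub_mul_rpow (half_pos hc) hd hq0 hq2 (norm_nonneg w.2.1.2)
  change m ≤ _ at h1 h2
  have h3 := hρ _ hle
  have h4 := hF w hw
  simp only [normH_sq, dirichlet_eq_norm_sq] at h3
  linarith

end LaplacianSystem

end

theorem theorem2p5 (N : ℕ) (hN : 1 ≤ N)
    (Ω : Set (LaplacianSystem.E N)) (hΩ : IsOpen Ω) (hΩb : Bornology.IsBounded Ω)
    (a b : LaplacianSystem.E N → ℝ)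
    (ha : ContinuousOn a (closure Ω)) (hb : ContinuousOn b (closure Ω))
    (q α β lam : ℝ) (hq1 : 1 < q) (hq2 : q < 2) (hα : 1 < α) (hβ : 1 < β)
    (hcrit : 3 ≤ N → α + β < 2 * (N : ℝ) / ((N : ℝ) - 2)) :
    LaplacianSystem.CoerciveOn (LaplacianSystem.J a b q α β lam)
        (LaplacianSystem.nehari Ω a b q α β lam) ∧
    BddBelow (LaplacianSystem.J a b q α β lam '' LaplacianSystem.nehari Ω a b q α β lam) ∧
    ∀ w ∈ LaplacianSystem.nehari Ω a b q α β lam,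
      (LaplacianSystem.sobolevConst Ω (α + β) ^ (2 * q / (2 - q)) * (q - 2)
            * (α + β - q) ^ (2 / (2 - q))
          / (2 * q * (α + β) * (α + β - 2) ^ (q / (2 - q))))
        * ((|lam| * LaplacianSystem.normL Ω a ((α + β) / (α + β - q))) ^ (2 / (2 - q))
          + (|lam| * LaplacianSystem.normL Ω a ((α + β) / (α + β - q))) ^ (2 / (2 - q)))
        ≤ LaplacianSystem.J a b q α β lam w := by
  have hp : 2 < α + β := by linarith
  have hp2 : 0 < α + β - 2 := by linarith
  have hp0 : 0 < α + β := by linarith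
  have hpq : 0 < α + β - q := by linarith
  have hq0 : 0 < q := by linarith
  set S := LaplacianSystem.sobolevConst Ω (α + β)
  set k := |lam| * LaplacianSystem.normL Ω a ((α + β) / (α + β - q))
  have hS : 0 ≤ S := LaplacianSystem.sobolevConst_nonneg Ω _
  have hk : 0 ≤ k := mul_nonneg (abs_nonneg _) ENNReal.toReal_nonneg
  have hSq : 0 ≤ S ^ q := Real.rpow_nonneg hS q
  have hc : 0 < (α + β - 2) / (2 * (α + β)) := by positivity
  have hd : 0 ≤ (α + β - q) / ((α + β) * q) * (k * S ^ q) := by positivity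
  have hJ := fun w hw => LaplacianSystem.le_J_of_mem_nehari hN hΩ hΩb (b := b) (lam := lam) ha
    hq0 hq2 (by linarith) (by linarith) hp hcrit (w := w) hw
  have key : ∀ w ∈ LaplacianSystem.nehari Ω a b q α β lam,
      (S ^ (2 * q / (2 - q)) * (q - 2) * (α + β - q) ^ (2 / (2 - q))
          / (2 * q * (α + β) * (α + β - 2) ^ (q / (2 - q))))
        * (k ^ (2 / (2 - q)) + k ^ (2 / (2 - q))) ≤
          LaplacianSystem.J a b q α β lam w := fun w hw => by
    -- The components are minimized separately, hence the two equal summands in the bound.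
    refine le_trans (le_of_eq ?_) ((add_le_add
      (LaplacianSystem.min_le_mul_sq_sub_mul_rpow hc hd hq0 hq2 (norm_nonneg w.1.1.2))
      (LaplacianSystem.min_le_mul_sq_sub_mul_rpow hc hd hq0 hq2 (norm_nonneg w.2.1.2))).trans (hJ w hw))
    rw [LaplacianSystem.young_constant_eq hq0 hq2 hp hk hS]
    ring
  refine ⟨?_, ⟨_, Set.forall_mem_image.2 key⟩, key⟩
  exact LaplacianSystem.coerciveOn_of_le hc hd hq0 hq2 hJ
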